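/- For $n\ge 1$ let $Z_n$ be the zig-zag poset on $\{x_1,\dots,x_n\}$, whose covering relations are $x_1\succ x_2\prec x_3\succ x_4\prec\cdots$ (that is, $x_{2i}\prec x_{2i-1}$ and $x_{2i}\prec x_{2i+1}$ whenever both elements exist). The order polynomial of a finite poset $P$ is the unique polynomial $\Omega(P;t)\in\mathbb{Q}[t]$ whose value at each positive integer $t$ is the number of maps $f:P\to\{1,\dots,t\}$ with $f(x)\le f(y)$ whenever $x\preceq y$. The order polytope of $P$ is \[ \mathscr{O}(P)=\{f\in[0,1]^P : f(u)\le f(v)\text{ for all }u\preceq v\text{ in }P\}. \] The Ehrhart polynomial of a lattice polytope $\mathscr{P}\subseteq\mathbb{R}^m$ is the unique polynomial $\operatorname{ehr}(\mathscr{P},t)\in\mathbb{Q}[t]$ with $\operatorname{ehr}(\mathscr{P},t)=\#(t\mathscr{P}\cap\mathbb{Z}^m)$ for each positive integer $t$; $\mathscr{P}$ is Ehrhart positive if all coefficients of $\operatorname{ehr}(\mathscr{P},t)$ are nonnegative. Corollary. For every $n\ge 2$, all coefficients of the order polynomial $\Omega(Z_n;t)$ are nonnegative. Moreover $\operatorname{ehr}(\mathscr{O}(Z_n),t)=\Omega(Z_n;t+1)$,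 and hence the order polytope $\mathscr{O}(Z_n)$ is Ehrhart positive. -/

import Mathlib

open Polynomial
open scoped Pointwise

/-- `Ω` is the order polynomial of the finite poset `P`: for each positive integer `t`, its value
at `t` is the number of order preserving maps from `P` to `{1, …, t}`. -/
def IsOrderPolynomial (P : Type*) [PartialOrder P] [Finite P] (Ω : ℚ[X]) : Prop :=
  ∀ t : ℕ, 0 < t → Ω.eval (t : ℚ) = (Nat.card (P →o Set.Icc 1 t) : ℚ)

/-- The order polytope of the finite poset `P`, as a subset of `ℝ^P`. -/
def orderPolytope (P : Type*) [PartialOrder P] [Finite P] : Set (P → ℝ) :=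
  {f | (∀ u, f u ∈ Set.Icc (0 : ℝ) 1) ∧ ∀ u v, u ≤ v → f u ≤ f v}

/-- `E` is the Ehrhart polynomial of the polytope `S ⊆ ℝ^ι`: for each positive integer `t`, its
value at `t` is the number of integer points of the dilation `t • S`. -/
def IsEhrhartPolynomial {ι : Type*} [Finite ι] (S : Set (ι → ℝ)) (E : ℚ[X]) : Prop :=
  ∀ t : ℕ, 0 < t →
    E.eval (t : ℚ) = (Set.ncard {z : ι → ℤ | (fun i => (z i : ℝ)) ∈ (t : ℝ) • S} : ℚ)

/-- The polytope `S` has an Ehrhart polynomial, and all the coefficients of that polynomial are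
nonnegative. -/
def EhrhartPositive {ι : Type*} [Finite ι] (S : Set (ι → ℝ)) : Prop :=
  ∃ E : ℚ[X], IsEhrhartPolynomial S E ∧ ∀ i : ℕ, 0 ≤ E.coeff i

/-- A polynomial is determined by its values at the positive integers. -/
theorem polynomial_eq_of_eval_pos_nat {p q : ℚ[X]}
    (h : ∀ t : ℕ, 0 < t → p.eval (t : ℚ) = q.eval (t : ℚ)) : p = q := by
  apply Polynomial.eq_of_infinite_eval_eq
  refine Set.Infinite.mono (s := (fun t : ℕ => (t : ℚ)) '' Set.Ioi 0) ?_
    ((Set.Ioi_infinite 0).image Nat.cast_injective.injOn)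
  rintro _ ⟨t, ht, rfl⟩
  exact h t ht

/-- A poset has at most one order polynomial. -/
theorem IsOrderPolynomial.unique {P : Type*} [PartialOrder P] [Finite P] {Ω Ω' : ℚ[X]}
    (h : IsOrderPolynomial P Ω) (h' : IsOrderPolynomial P Ω') : Ω = Ω' :=
  polynomial_eq_of_eval_pos_nat fun t ht => (h t ht).trans (h' t ht).symm

/-- A polytope has at most one Ehrhart polynomial. -/
theorem IsEhrhartPolynomial.unique {ι : Type*} [Finite ι] {S : Set (ι → ℝ)} {E E' : ℚ[X]}
    (h : IsEhrhartPolynomial S E) (h' : IsEhrhartPolynomial S E') : E = E' :=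
  polynomial_eq_of_eval_pos_nat fun t ht => (h t ht).trans (h' t ht).symm

/-- The ground set `{x₁, …, xₙ}` of the zig-zag poset: `i : Fin n` stands for the element `x_(i+1)`.
The order is not that of `Fin n`; it is defined below. -/
def ZigZag (n : ℕ) : Type := Fin n

instance (n : ℕ) : Fintype (ZigZag n) := inferInstanceAs (Fintype (Fin n))

instance (n : ℕ) : DecidableEq (ZigZag n) := inferInstanceAs (DecidableEq (Fin n))

/-- The position of an element, counted from `0`. -/
def ZigZag.pos {n : ℕ} (a : ZigZag n) : ℕ := Fin.val (n := n) a

/-- The zig-zag order `x₁ > x₂ < x₃ > x₄ < ⋯`: the elements at odd positions (counted from `0`) are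
below their neighbours, and there are no further strict relations. -/
instance (n : ℕ) : PartialOrder (ZigZag n) where
  le a b := a = b ∨ (Odd a.pos ∧ (b.pos = a.pos + 1 ∨ a.pos = b.pos + 1))
  le_refl a := Or.inl rfl
  le_trans a b c := by
    rintro (rfl | ⟨ha, hab⟩) (rfl | ⟨hb, hbc⟩)
    · exact Or.inl rfl
    · exact Or.inr ⟨hb, hbc⟩
    · exact Or.inr ⟨ha, hab⟩
    · grind
  le_antisymm a b := by
    rintro (rfl | ⟨ha, hab⟩) (h | ⟨hb, hbc⟩)
    · rfl
    · rfl
    · exact h.symm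
    · grind

/-! Reversing the values at every other position turns order preserving maps into sequences whose
neighbouring entries have sum below `t`. Let `F j` be their generating function over the length,
with first entry below `j`. Then `F 0 = 1` and `F (j + 1) = F j + X * F (t - j)`. With `X = 2 sin θ`
this recursion is solved, up to a common factor, by `sin (π / 4 + (2 * j - t) θ - θ / 2)`, so for `T
= tan (π / 4 + t θ)` and `u = tan (θ / 2)` one gets `F t = (T - u) / (1 - T * u) = T + u * (T ^ 2 -
1) / (1 - T * u)`.

Positivity comes from the last form: `u`, `θ'`, `T - 1` and `1 / (1 - T * u)` all solve equations
free of subtraction. They can therefore be solved over the semiring `ℚ≥0[X]`, whose variable plays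
the role of `t`, and nonnegativity of the coefficients is built into the type. The main lemmas are
`pathSeries_closed_form` and `exists_tangent_series`. -/

namespace PowerSeries

/-! ### Solving equations in formal power series over semirings -/

open Finset

theorem coeff_mul_congr {R : Type*} [Semiring R] {f f' g g' : R⟦X⟧} {n : ℕ}
    (hf : ∀ m ≤ n, coeff m f = coeff m f') (hg : ∀ m ≤ n, coeff m g = coeff m g') :
    coeff n (f * g) = coeff n (f' * g') := by
  rw [coeff_mul, coeff_mul]
  refine sum_congr rfl fun x hx => ?_
  have := mem_antidiagonal.1 hx
  rw [hf _ (by omega), hg _ (by omega)]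

/-- A self-map of power series whose `n`-th output coefficient depends only on the input
coefficients below `n` has a fixed point. -/
theorem exists_fixedPoint {R : Type*} [Semiring R] (Φ : R⟦X⟧ → R⟦X⟧)
    (h : ∀ n f g, (∀ m < n, coeff m f = coeff m g) → coeff n (Φ f) = coeff n (Φ g)) :
    ∃ f, f = Φ f := by
  -- The `n`-th coefficient of the iterates of `Φ` at `0` is constant from the iterate `n + 1` on;
  -- these stable values form the fixed point.
  have key : ∀ n, ∀ k, n < k → ∀ l, n < l → coeff n (Φ^[k] 0) = coeff n (Φ^[l] 0) := by
    intro n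
    induction n using Nat.strong_induction_on with
    | _ n ih =>
      rintro (_ | k) hk (_ | l) hl
      · omega
      · omega
      · omega
      · rw [Function.iterate_succ_apply', Function.iterate_succ_apply']
        exact h _ _ _ fun m hm => ih m hm _ (by omega) _ (by omega)
  refine ⟨mk fun n => coeff n (Φ^[n + 1] 0), ?_⟩
  ext n
  rw [coeff_mk, Function.iterate_succ_apply']
  refine h _ _ _ fun m hm => ?_
  rw [coeff_mk]
  exact key m _ hm _ (by omega)

theorem exists_eq_add_X_mul {R : Type*} [Semiring R] (a : R⟦X⟧) (Ψ : R⟦X⟧ → R⟦X⟧)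
    (h : ∀ n f g, (∀ m ≤ n, coeff m f = coeff m g) → coeff n (Ψ f) = coeff n (Ψ g)) :
    ∃ f, f = a + X * Ψ f := by
  apply exists_fixedPoint fun f => a + X * Ψ f
  rintro (_ | n) f g hfg
  · simp
  · simp only [map_add, coeff_succ_X_mul]
    rw [h n f g fun m hm => hfg m (by omega)]

/-- Over a `ℚ≥0`-algebra, the initial value problem `f' = Ψ f`, `f 0 = a` has a formal solution. -/
theorem exists_derivative_eq {R : Type*} [CommSemiring R] [Algebra ℚ≥0 R] (a : R)
    (Ψ : R⟦X⟧ → R⟦X⟧)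
    (h : ∀ n f g, (∀ m ≤ n, coeff m f = coeff m g) → coeff n (Ψ f) = coeff n (Ψ g)) :
    ∃ f, constantCoeff f = a ∧ derivative R f = Ψ f := by
  obtain ⟨f, hf⟩ := exists_eq_add_X_mul (C a)
    (fun f => mk fun n => algebraMap ℚ≥0 R ((n : ℚ≥0) + 1)⁻¹ * coeff n (Ψ f)) (by
      intro n f g hfg
      simp only [coeff_mk]
      rw [h n f g hfg])
  refine ⟨f, by rw [hf]; simp, ?_⟩
  ext n
  rw [PowerSeries.coeff_derivative]
  conv_lhs => rw [hf]
  rw [map_add, coeff_succ_X_mul, coeff_mk, coeff_succ_C, zero_add]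
  have : algebraMap ℚ≥0 R ((n : ℚ≥0) + 1)⁻¹ * ((n : R) + 1) = 1 := by
    have h1 : ((n : R) + 1) = algebraMap ℚ≥0 R ((n : ℚ≥0) + 1) := by simp
    rw [h1, ← map_mul, inv_mul_cancel₀ (by positivity), map_one]
  rw [mul_right_comm, this, one_mul]

/-- The zero solution is the only solution of `f' = q f` with `f 0 = 0`. -/
theorem eq_zero_of_derivative_eq_mul {K : Type*} [Field K] [CharZero K] {f q : K⟦X⟧}
    (h0 : constantCoeff f = 0) (h : derivative K f = q * f) : f = 0 := by
  ext n
  induction n using Nat.strong_induction_on with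
  | _ n ih =>
    rcases n with _ | n
    · simpa using h0
    · have h1 := congrArg (coeff n) h
      rw [coeff_mul_congr (f' := q) (g' := 0) (fun _ _ => rfl)
        (fun m hm => ih m (by omega)), mul_zero, PowerSeries.coeff_derivative] at h1
      simpa [Nat.cast_add_one_ne_zero] using h1

end PowerSeries

/-! ### From order preserving maps to sequences with bounded neighbour sums -/

/-- The number of sequences `h` of length `n` of natural numbers with `h 0 < j` and
`h i + h (i + 1) < t`, computed by recursion on the first entry. -/
def pathCount (t : ℕ) : ℕ → ℕ → ℕ
  | 0, _ => 1
  | n + 1, j => ∑ i ∈ Finset.range j, pathCount t n (t - i)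

/-- A sequence with entries below `t`, sums of neighbours below `t`, and first entry below `j`. -/
def IsPath (t n j : ℕ) (h : Fin n → Fin t) : Prop :=
  (∀ i (hi : i + 1 < n), (h ⟨i, by omega⟩ : ℕ) + h ⟨i + 1, hi⟩ < t) ∧
    ∀ hn : 0 < n, (h ⟨0, hn⟩ : ℕ) < j

theorem isPath_cons {t n j : ℕ} (a : Fin t) (h : Fin n → Fin t) :
    IsPath t (n + 1) j (Fin.cons a h) ↔ (a : ℕ) < j ∧ IsPath t n (t - a) h := by
  constructor
  · rintro ⟨h1, h2⟩
    refine ⟨by simpa using h2 (by omega), fun i hi => ?_, fun hn => ?_⟩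
    · exact h1 (i + 1) (by omega)
    · have : (a : ℕ) + h ⟨0, hn⟩ < t := h1 0 (Nat.succ_lt_succ hn)
      omega
  · rintro ⟨h0, h1, h2⟩
    refine ⟨?_, fun _ => h0⟩
    rintro (_ | i) hi
    · have := h2 (by omega)
      change (a : ℕ) + h ⟨0, by omega⟩ < t
      omega
    · exact h1 i (by omega)

theorem card_isPath (t n : ℕ) : ∀ j ≤ t,
    Nat.card {h : Fin n → Fin t // IsPath t n j h} = pathCount t n j := by
  induction n with
  | zero =>
    intro j _
    have : Unique {h : Fin 0 → Fin t // IsPath t 0 j h} :=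
      { default := ⟨Fin.elim0, fun i hi => by omega, fun hn => by omega⟩
        uniq := fun a => Subsingleton.elim _ _ }
    rw [Nat.card_unique, pathCount]
  | succ n ih =>
    intro j hj
    have e : {h : Fin (n + 1) → Fin t // IsPath t (n + 1) j h} ≃
        Σ i : Fin j, {h : Fin n → Fin t // IsPath t n (t - i) h} :=
      { toFun := fun h => ⟨⟨h.1 0, h.2.2 (by omega)⟩, Fin.tail h.1,
          ((isPath_cons (j := j) (h.1 0) (Fin.tail h.1)).1
            ((Fin.cons_self_tail h.1).symm ▸ h.2)).2⟩
        invFun := fun s => ⟨Fin.cons ⟨s.1, s.1.2.trans_le hj⟩ s.2.1,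
          (isPath_cons _ _).2 ⟨s.1.2, s.2.2⟩⟩
        left_inv := fun h => Subtype.ext (Fin.cons_self_tail h.1)
        right_inv := fun s => rfl }
    rw [Nat.card_congr e, Nat.card_sigma, pathCount, ← Fin.sum_univ_eq_sum_range
      (fun i => pathCount t n (t - i))]
    exact Finset.sum_congr rfl fun i _ => ih _ (by omega)

/-- Reverse the values of an alternating sequence at the even positions. -/
def alternateFlip (t n : ℕ) : (ZigZag n → Set.Icc 1 t) ≃ (Fin n → Fin t) where
  toFun f i := if Even (i : ℕ) then ⟨t - (f i : ℕ), by have h1 := (f i).2.1; have h2 := (f i).2.2; omega⟩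
    else ⟨(f i : ℕ) - 1, by have h1 := (f i).2.1; have h2 := (f i).2.2; omega⟩
  invFun h i := if Even i.pos then ⟨t - (h i : ℕ), by rw [Set.mem_Icc]; omega⟩
    else ⟨(h i : ℕ) + 1, by rw [Set.mem_Icc]; omega⟩
  left_inv f := by
    funext i
    have := (f i).2
    simp only [Set.mem_Icc] at this
    by_cases hi : Even i.pos
    · have hi' : Even (Fin.val (n := n) i) := hi
      apply Subtype.ext
      simp only [hi, hi', if_true]
      omega
    · have hi' : ¬ Even (Fin.val (n := n) i) := hi
      apply Subtype.ext
      simp only [hi, hi', if_false]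
      omega
  right_inv h := by
    funext i
    by_cases hi : Even (i : ℕ)
    · have hi' : Even (ZigZag.pos (n := n) i) := hi
      apply Fin.ext
      simp only [hi, hi', if_true]
      omega
    · have hi' : ¬ Even (ZigZag.pos (n := n) i) := hi
      apply Fin.ext
      simp only [hi, hi', if_false]
      omega

/-- At an even position `f = t - h`, at an odd one `f = h + 1`; thus odd `≤` even says exactly that
the two neighbouring values of `h` have sum below `t`. -/
theorem monotone_iff_isPath_alternateFlip {t n : ℕ} (f : ZigZag n → Set.Icc 1 t) :
    Monotone f ↔ IsPath t n t (alternateFlip t n f) := by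
  have hb : ∀ i, 1 ≤ (f i : ℕ) ∧ (f i : ℕ) ≤ t := fun i => (f i).2
  have val_even : ∀ (i : ℕ) (hi : i < n), Even i →
      (alternateFlip t n f ⟨i, hi⟩ : ℕ) = t - (f (⟨i, hi⟩ : Fin n) : ℕ) := by
    intro i hi he
    simp [alternateFlip, he]
  have val_odd : ∀ (i : ℕ) (hi : i < n), ¬ Even i →
      (alternateFlip t n f ⟨i, hi⟩ : ℕ) = (f (⟨i, hi⟩ : Fin n) : ℕ) - 1 := by
    intro i hi he
    simp [alternateFlip, he]
  constructor
  · intro hf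
    refine ⟨fun i hi => ?_, fun hn => Fin.is_lt _⟩
    have h1 := hb (⟨i, by omega⟩ : Fin n)
    have h2 := hb (⟨i + 1, by omega⟩ : Fin n)
    rcases Nat.even_or_odd i with he | ho
    · rw [val_even i _ he, val_odd (i + 1) _ (by grind)]
      have : (f (⟨i + 1, hi⟩ : Fin n) : ℕ) ≤ f (⟨i, by omega⟩ : Fin n) :=
        hf (a := (⟨i + 1, hi⟩ : Fin n)) (b := (⟨i, by omega⟩ : Fin n))
          (Or.inr ⟨he.add_one, Or.inr rfl⟩)
      omega
    · rw [val_odd i _ (by grind), val_even (i + 1) _ (by grind)]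
      have : (f (⟨i, by omega⟩ : Fin n) : ℕ) ≤ f (⟨i + 1, hi⟩ : Fin n) :=
        hf (a := (⟨i, by omega⟩ : Fin n)) (b := (⟨i + 1, hi⟩ : Fin n))
          (Or.inr ⟨ho, Or.inl rfl⟩)
      omega
  · rintro ⟨h, -⟩ ⟨a, ha⟩ ⟨b, hb'⟩ (hab | ⟨ho, hab | hab⟩)
    · exact (congrArg f hab).le
    · change Odd a at ho
      change b = a + 1 at hab
      subst hab
      have h1 := hb (⟨a, by omega⟩ : Fin n)
      have h2 := hb (⟨a + 1, by omega⟩ : Fin n)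
      have h3 := h a hb'
      rw [val_odd a _ (by grind), val_even (a + 1) _ (by grind)] at h3
      change (f (⟨a, ha⟩ : Fin n) : ℕ) ≤ f (⟨a + 1, hb'⟩ : Fin n)
      omega
    · change Odd a at ho
      change a = b + 1 at hab
      subst hab
      have h1 := hb (⟨b, by omega⟩ : Fin n)
      have h2 := hb (⟨b + 1, by omega⟩ : Fin n)
      have h3 := h b ha
      rw [val_odd (b + 1) _ (by grind), val_even b _ (by grind)] at h3
      change (f (⟨b + 1, ha⟩ : Fin n) : ℕ) ≤ f (⟨b, hb'⟩ : Fin n)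
      omega

theorem card_zigZag_orderHom (n t : ℕ) :
    Nat.card (ZigZag n →o Set.Icc 1 t) = pathCount t n t := by
  rw [← card_isPath t n t le_rfl]
  refine Nat.card_congr (Equiv.trans ?_
    ((alternateFlip t n).subtypeEquiv monotone_iff_isPath_alternateFlip))
  exact ⟨fun f => ⟨f, f.monotone⟩, fun f => ⟨f.1, f.2⟩, fun _ => rfl, fun _ => rfl⟩

/-! ### Lattice points of the order polytope -/

/-- The Ehrhart polynomial of the order polytope is a shift of the order polynomial. -/
theorem IsOrderPolynomial.isEhrhartPolynomial {P : Type*} [PartialOrder P] [Finite P] {Ω : ℚ[X]}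
    (h : IsOrderPolynomial P Ω) : IsEhrhartPolynomial (orderPolytope P) (Ω.comp (X + 1)) := by
  intro t ht
  have h1 := h (t + 1) (by omega)
  rw [eval_comp]
  simp only [eval_add, eval_X, eval_one]
  push_cast at h1
  rw [h1, Nat.cast_inj, ← Nat.card_coe_set_eq]
  have ht' : (0 : ℝ) < t := by exact_mod_cast ht
  have mem : ∀ z : P → ℤ, (fun i => (z i : ℝ)) ∈ (t : ℝ) • orderPolytope P ↔
      (∀ u, 0 ≤ z u ∧ z u ≤ t) ∧ ∀ u v, u ≤ v → z u ≤ z v := by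
    intro z
    rw [Set.mem_smul_set_iff_inv_smul_mem₀ ht'.ne']
    refine and_congr (forall_congr' fun u => and_congr ?_ ?_)
      (forall_congr' fun u => forall_congr' fun v => imp_congr Iff.rfl ?_)
    · simp only [Pi.smul_apply, smul_eq_mul]
      rw [mul_nonneg_iff_of_pos_left (by positivity)]
      norm_cast
    · simp only [Pi.smul_apply, smul_eq_mul]
      rw [inv_mul_le_iff₀ ht', mul_one]
      norm_cast
    · simp only [Pi.smul_apply, smul_eq_mul]
      rw [mul_le_mul_iff_right₀ (by positivity)]
      norm_cast
  -- The lattice points are the order preserving maps into `{0, …, t}`; adding `1` moves the values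
  -- to `{1, …, t + 1}`.
  refine Nat.card_congr
    { toFun := fun f => ⟨fun u => ((f u : ℕ) : ℤ) - 1, (mem _).2 ⟨fun u => ?_, fun u v huv => ?_⟩⟩
      invFun := fun z => ⟨fun u => ⟨(z.1 u + 1).toNat, ?_⟩, fun u v huv => ?_⟩
      left_inv := fun f => ?_
      right_inv := fun z => ?_ }
  · have := (f u).2
    simp only [Set.mem_Icc] at this
    omega
  · have : (f u : ℕ) ≤ f v := f.monotone huv
    omega
  · have := ((mem _).1 z.2).1 u
    simp only [Set.mem_Icc]
    omega
  · have := ((mem _).1 z.2).2 u v huv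
    change (z.1 u + 1).toNat ≤ (z.1 v + 1).toNat
    omega
  · ext u
    simp
  · apply Subtype.ext
    funext u
    have := ((mem _).1 z.2).1 u
    change ((z.1 u + 1).toNat : ℤ) - 1 = z.1 u
    omega

/-! ### The generating function and its closed form -/

/-- The generating function, over the length, of `pathCount`. -/
noncomputable def pathSeries (t j : ℕ) : PowerSeries ℂ :=
  PowerSeries.mk fun n => (pathCount t n j : ℂ)

theorem pathSeries_zero (t : ℕ) : pathSeries t 0 = 1 := by
  ext n
  rcases n with _ | n <;> simp [pathSeries, pathCount, PowerSeries.coeff_one]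

theorem pathSeries_succ (t j : ℕ) :
    pathSeries t (j + 1) = pathSeries t j + PowerSeries.X * pathSeries t (t - j) := by
  ext n
  rcases n with _ | n
  · simp [pathSeries, pathCount]
  · rw [map_add, PowerSeries.coeff_succ_X_mul]
    simp [pathSeries, pathCount, Finset.sum_range_succ]

/-- The recursion of `pathSeries` determines its solutions up to a factor. -/
theorem eq_mul_pathSeries {t : ℕ} {a : ℕ → PowerSeries ℂ}
    (h : ∀ j < t, a (j + 1) = a j + PowerSeries.X * a (t - j)) :
    ∀ j ≤ t, a j = a 0 * pathSeries t j := by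
  -- Induction on the degree, then on `j`: the index `t - j` may exceed `j`, but its term carries a
  -- factor `X` and so only involves the previous degree.
  have key : ∀ n, ∀ j ≤ t, PowerSeries.coeff n (a j - a 0 * pathSeries t j) = 0 := by
    intro n
    induction n with
    | zero =>
      intro j
      induction j with
      | zero => simp [pathSeries_zero]
      | succ j ih =>
        intro hj
        have := ih (by omega)
        rw [h j hj, pathSeries_succ]
        simp only [map_sub, map_add, mul_add, PowerSeries.coeff_zero_eq_constantCoeff, map_mul,
          PowerSeries.constantCoeff_X, zero_mul, mul_zero, add_zero] at this ⊢
        exact this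
    | succ n ihn =>
      intro j
      induction j with
      | zero => simp [pathSeries_zero]
      | succ j ih =>
        intro hj
        have h1 := ih (by omega)
        have h2 := ihn (t - j) (by omega)
        have h3 : a (j + 1) - a 0 * pathSeries t (j + 1) = (a j - a 0 * pathSeries t j) +
            PowerSeries.X * (a (t - j) - a 0 * pathSeries t (t - j)) := by
          rw [h j hj, pathSeries_succ]
          ring
        rw [h3, map_add, h1, PowerSeries.coeff_succ_X_mul, h2, add_zero]
  intro j hj
  rw [← sub_eq_zero]
  ext n
  simpa using key n j hj

namespace PowerSeries

/-- A closed form for `pathSeries`: with `X = 2 sin θ`, `u = tan (θ / 2)`, `p = θ'` and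
`T = tan (π / 4 + t θ)`. -/
theorem pathSeries_closed_form {t : ℕ} {u p T : PowerSeries ℂ} (hu : 4 * u = X * (1 + u ^ 2))
    (hp : p * (2 - X * u) = 1) (hT0 : constantCoeff T = 1)
    (hT : derivative ℂ T = t * p * (1 + T ^ 2)) :
    (1 - T * u) * pathSeries t t = T - u := by
  have hu0 : constantCoeff u = 0 := by
    have h4 : constantCoeff (4 : PowerSeries ℂ) = 4 := map_ofNat _ 4
    simpa [h4] using congrArg constantCoeff hu
  obtain ⟨I, hI, hdI⟩ : ∃ I : PowerSeries ℂ, I ^ 2 = -1 ∧ derivative ℂ I = 0 := by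
    refine ⟨C Complex.I, ?_, derivative_C⟩
    rw [← map_pow, Complex.I_sq, map_neg, map_one]
  have hm : (1 - I * u) * (1 - I * u)⁻¹ = 1 := PowerSeries.mul_inv_cancel _ (by simp [hu0])
  have hq : (1 + I * u) * (1 + I * u)⁻¹ = 1 := PowerSeries.mul_inv_cancel _ (by simp [hu0])
  set m := (1 - I * u)⁻¹ with hm_def
  set q := (1 + I * u)⁻¹ with hq_def
  -- `w` and `v` are `exp (I θ)` and `exp (-I θ)`, in terms of the half-angle tangent.
  obtain ⟨w, hw⟩ : ∃ w, w = (1 + I * u) * m := ⟨_, rfl⟩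
  obtain ⟨v, hv⟩ : ∃ v, v = (1 - I * u) * q := ⟨_, rfl⟩
  have hwv : w * v = 1 := by
    rw [hw, hv]
    linear_combination (q * (1 + I * u)) * hm + hq
  have hw0 : constantCoeff w = 1 := by
    simp [hw, hm_def, hu0]
  have hv0 : constantCoeff v = 1 := by
    simp [hv, hq_def, hu0]
  have hpu : p * (1 + u ^ 2) = 2 * derivative ℂ u := by
    have h4 : derivative ℂ (4 : PowerSeries ℂ) = 0 := by
      exact_mod_cast (derivative ℂ).map_natCast 4
    have h1 := congrArg (derivative ℂ) hu
    simp only [Derivation.leibniz, Derivation.leibniz_pow, derivative_X, map_add, h4,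
      derivative_one, smul_eq_mul] at h1
    have h2 : (1 + u ^ 2) = 2 * derivative ℂ u * (2 - X * u) := by
      linear_combination -h1
    linear_combination p * h2 + 2 * derivative ℂ u * hp
  have hdw : derivative ℂ w = I * p * w := by
    have h1 : w * (1 - I * u) = 1 + I * u := by rw [hw]; linear_combination (1 + I * u) * hm
    have h2 := congrArg (derivative ℂ) h1
    simp only [Derivation.leibniz, map_add, map_sub, hdI, derivative_one, smul_eq_mul] at h2
    have h3 : (derivative ℂ w - I * p * w) * (1 - I * u) ^ 2 = 0 := by
      linear_combination (1 - I * u) * h2 - (I * p * (1 - I * u) - I * derivative ℂ u) * h1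
        - I * hpu + I * p * u ^ 2 * hI
    have h4 : (1 - I * u) ≠ 0 := left_ne_zero_of_mul_eq_one hm
    exact sub_eq_zero.1 ((mul_eq_zero.1 h3).resolve_right (pow_ne_zero _ h4))
  have hdv : derivative ℂ v = -(I * p * v) := by
    have h2 := congrArg (derivative ℂ) hwv
    simp only [Derivation.leibniz, derivative_one, smul_eq_mul, hdw] at h2
    linear_combination v * h2 - (derivative ℂ v + I * p * v) * hwv
  have hdpow : ∀ k : ℕ, derivative ℂ (w ^ k) = k * (I * p * w ^ k) ∧
      derivative ℂ (v ^ k) = -(k * (I * p * v ^ k)) := by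
    intro k
    induction k with
    | zero => simp
    | succ k ih =>
      simp only [pow_succ, Derivation.leibniz, ih.1, ih.2, hdw, hdv, smul_eq_mul]
      push_cast
      constructor <;> ring
  -- multiples of `sin (π / 4 + t θ)` and `cos (π / 4 + t θ)`
  obtain ⟨S, hS⟩ : ∃ S, S = (1 - I) * w ^ t + (1 + I) * v ^ t := ⟨_, rfl⟩
  obtain ⟨D, hD⟩ : ∃ D, D = (1 + I) * w ^ t + (1 - I) * v ^ t := ⟨_, rfl⟩
  have hdS : derivative ℂ S = t * p * D := by
    rw [hS, hD]
    simp only [map_add, map_sub, Derivation.leibniz, hdI, derivative_one, smul_eq_mul,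
      (hdpow t).1, (hdpow t).2]
    linear_combination -(t * p * w ^ t + t * p * v ^ t) * hI
  have hdD : derivative ℂ D = -(t * p * S) := by
    rw [hS, hD]
    simp only [map_add, map_sub, Derivation.leibniz, hdI, derivative_one, smul_eq_mul,
      (hdpow t).1, (hdpow t).2]
    linear_combination (t * p * w ^ t + t * p * v ^ t) * hI
  have hD0 : constantCoeff D = 2 := by
    simp only [hD, map_add, map_mul, map_sub, map_pow, hw0, hv0, map_one, one_pow, mul_one]
    ring
  have hS0 : constantCoeff S = 2 := by
    simp only [hS, map_add, map_mul, map_sub, map_pow, hw0, hv0, map_one, one_pow, mul_one]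
    ring
  -- The difference solves a homogeneous linear differential equation and vanishes at `0`.
  have hST : S - T * D = 0 := by
    apply eq_zero_of_derivative_eq_mul (q := (t : PowerSeries ℂ) * p * T)
    · simp [hS0, hD0, hT0]
    · simp only [map_sub, Derivation.leibniz, smul_eq_mul, hdS, hdD, hT]
      ring
  have hD_ne : D ≠ 0 := by
    rintro rfl
    simp at hD0
  have hu2 : (1 + u ^ 2) ≠ 0 := by
    intro h
    simpa [hu0] using congrArg constantCoeff h
  -- The recursion compared at one exponential; `J = I` and `J = -I` give the two conjugate halves.
  have step : ∀ J z : PowerSeries ℂ, J ^ 2 = -1 → z * (1 - J * u) = 1 + J * u →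
      ((1 - J) - u * (1 + J)) * (z ^ 2 - 1) = X * ((1 + J) - u * (1 - J)) := by
    intro J z hJ h1
    have h2 : (z ^ 2 - 1) * (1 - J * u) ^ 2 = 4 * (J * u) := by
      linear_combination (z * (1 - J * u) + 1 + J * u) * h1
    have h3 : (((1 - J) - u * (1 + J)) * (z ^ 2 - 1) - X * ((1 + J) - u * (1 - J))) *
        ((1 - J * u) ^ 2 * (1 + u ^ 2)) = 0 := by
      linear_combination ((1 - J) - u * (1 + J)) * (1 + u ^ 2) * h2 +
        ((1 + J) - u * (1 - J)) * (1 - J * u) ^ 2 * hu + 4 * u * (-(u ^ 2 + u ^ 3) * J + (u - 1)) * hJ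
    have h4 : (1 - J * u) ≠ 0 := by
      intro h
      simpa [hu0] using congrArg constantCoeff h
    exact sub_eq_zero.1 ((mul_eq_zero.1 h3).resolve_right
      (mul_ne_zero (pow_ne_zero _ h4) hu2))
  have hw2 := step I w hI (by rw [hw]; linear_combination (1 + I * u) * hm)
  have hv2 := step (-I) v (by rw [neg_sq, hI])
    (by rw [hv]; linear_combination (1 - I * u) * hq)
  -- A multiple of `sin (π / 4 + (2 * j - t) θ - θ / 2)`, with `v ^ t` standing for `w ^ (-t)`. Its
  -- values at `0` and `t` are `D - u * S` and `S - u * D`.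
  have hrec := eq_mul_pathSeries (t := t)
    (a := fun j => (1 - I) * (w ^ (2 * j) * v ^ t) + (1 + I) * (v ^ (2 * j) * w ^ t) -
      u * ((1 + I) * (w ^ (2 * j) * v ^ t) + (1 - I) * (v ^ (2 * j) * w ^ t))) (by
    intro j hj
    obtain ⟨k, rfl⟩ := Nat.exists_eq_add_of_le hj.le
    have hcancel : ∀ k : ℕ, w ^ k * v ^ k = 1 := fun k => by rw [← mul_pow, hwv, one_pow]
    have e1 : w ^ (2 * j) * v ^ (j + k) = w ^ j * v ^ k := by
      linear_combination (w ^ j * v ^ k) * hcancel j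
    have e2 : v ^ (2 * j) * w ^ (j + k) = v ^ j * w ^ k := by
      linear_combination (v ^ j * w ^ k) * hcancel j
    have e3 : w ^ (2 * k) * v ^ (j + k) = v ^ j * w ^ k := by
      linear_combination (v ^ j * w ^ k) * hcancel k
    have e4 : v ^ (2 * k) * w ^ (j + k) = w ^ j * v ^ k := by
      linear_combination (w ^ j * v ^ k) * hcancel k
    have e5 : w ^ (2 * (j + 1)) * v ^ (j + k) = w ^ 2 * (w ^ j * v ^ k) := by
      rw [← e1]; ring
    have e6 : v ^ (2 * (j + 1)) * w ^ (j + k) = v ^ 2 * (v ^ j * w ^ k) := by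
      rw [← e2]; ring
    simp only [add_tsub_cancel_left, e1, e2, e3, e4, e5, e6]
    linear_combination (w ^ j * v ^ k) * hw2 + (v ^ j * w ^ k) * hv2)
  have h1 := hrec t le_rfl
  simp only [mul_zero, pow_zero, one_mul] at h1
  have e1 : w ^ (2 * t) * v ^ t = w ^ t := by
    have : w ^ t * v ^ t = 1 := by rw [← mul_pow, hwv, one_pow]
    linear_combination w ^ t * this
  have e2 : v ^ (2 * t) * w ^ t = v ^ t := by
    have : w ^ t * v ^ t = 1 := by rw [← mul_pow, hwv, one_pow]
    linear_combination v ^ t * this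
  rw [e1, e2, ← hS, ← hD] at h1
  apply mul_left_cancel₀ hD_ne
  linear_combination (1 + u * pathSeries t t) * hST - h1 + pathSeries t t * hD -
    u * pathSeries t t * hS

end PowerSeries

/-! ### Nonnegativity: the closed form without subtraction -/

namespace PowerSeries

/-- The series `tan (θ / 2)`, `θ'`, `tan (π / 4 + a θ) - 1` and
`(1 - tan (π / 4 + a θ) * tan (θ / 2))⁻¹`, where `X = 2 sin θ`, are defined without subtraction. -/
theorem exists_tangent_series {R : Type*} [CommSemiring R] [Algebra ℚ≥0 R] (a : R) :
    ∃ u p T H : R⟦X⟧, 4 * u = X * (1 + u ^ 2) ∧ 2 * p = 1 + X * u * p ∧ constantCoeff T = 0 ∧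
      derivative R T = C a * p * (1 + (1 + T) ^ 2) ∧ H = 1 + (1 + T) * u * H := by
  have inv_mul : ∀ k : ℕ, k ≠ 0 → (k : R⟦X⟧) * C (algebraMap ℚ≥0 R (k : ℚ≥0)⁻¹) = 1 := by
    intro k hk
    have h1 : (k : R⟦X⟧) = C (algebraMap ℚ≥0 R (k : ℚ≥0)) := by simp
    rw [h1, ← map_mul, ← map_mul, mul_inv_cancel₀ (by positivity), map_one, map_one]
  have h2 := inv_mul 2 (by norm_num)
  have h4 := inv_mul 4 (by norm_num)
  generalize C (algebraMap ℚ≥0 R ((2 : ℕ) : ℚ≥0)⁻¹) = b at h2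
  generalize C (algebraMap ℚ≥0 R ((4 : ℕ) : ℚ≥0)⁻¹) = c at h4
  push_cast at h2 h4
  obtain ⟨u, hu⟩ := exists_eq_add_X_mul (0 : R⟦X⟧) (fun f => c * (1 + f * f)) (by
    intro n f g h
    refine coeff_mul_congr (fun _ _ => rfl) fun m hm => ?_
    rw [map_add, map_add,
      coeff_mul_congr (fun k hk => h k (hk.trans hm)) fun k hk => h k (hk.trans hm)])
  rw [zero_add] at hu
  obtain ⟨p, hp⟩ := exists_eq_add_X_mul b (fun f => b * u * f) fun n f g h =>
    coeff_mul_congr (fun _ _ => rfl) h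
  obtain ⟨T, hT0, hT⟩ := exists_derivative_eq (0 : R)
    (fun f => C a * p * (1 + (1 + f) * (1 + f))) (by
    intro n f g h
    refine coeff_mul_congr (fun _ _ => rfl) fun m hm => ?_
    have h' : ∀ k ≤ m, coeff k (1 + f) = coeff k (1 + g) := fun k hk => by
      rw [map_add, map_add, h k (hk.trans hm)]
    rw [map_add, map_add, coeff_mul_congr h' h'])
  -- Here `u` is written as `X * (c * (1 + u * u))` to exhibit the factor `X`.
  obtain ⟨H, hH⟩ := exists_eq_add_X_mul (1 : R⟦X⟧)
    (fun f => (1 + T) * (c * (1 + u * u)) * f) fun n f g h =>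
    coeff_mul_congr (fun _ _ => rfl) h
  refine ⟨u, p, T, H, ?_, ?_, hT0, ?_, ?_⟩
  · calc 4 * u = 4 * (X * (c * (1 + u * u))) := by rw [← hu]
      _ = (4 * c) * (X * (1 + u ^ 2)) := by ring
      _ = X * (1 + u ^ 2) := by rw [h4, one_mul]
  · calc 2 * p = 2 * (b + X * (b * u * p)) := by rw [← hp]
      _ = (2 * b) * (1 + X * u * p) := by ring
      _ = 1 + X * u * p := by rw [h2, one_mul]
  · rw [hT, sq]
  · calc H = 1 + X * ((1 + T) * (c * (1 + u * u)) * H) := hH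
      _ = 1 + (1 + T) * (X * (c * (1 + u * u))) * H := by ring
      _ = 1 + (1 + T) * u * H := by rw [← hu]

theorem derivative_map {R S : Type*} [CommSemiring R] [CommSemiring S] (φ : R →+* S) (f : R⟦X⟧) :
    derivative S (map φ f) = map φ (derivative R f) := by
  ext n
  simp [PowerSeries.coeff_derivative]

/-- The counting sequence `pathCount t n t` is polynomial in `t`, with nonnegative coefficients. -/
theorem exists_series_map_eq_pathSeries : ∃ G : PowerSeries (ℚ≥0[X]), ∀ t : ℕ,
    map (Polynomial.eval₂RingHom (algebraMap ℚ≥0 ℂ) (t : ℂ)) G = pathSeries t t := by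
  obtain ⟨u, p, T, H, hu, hp, hT0, hT, hH⟩ := exists_tangent_series (Polynomial.X : ℚ≥0[X])
  -- From here `T` is the tangent minus `1`, so `T * (T + 2)` is the squared tangent minus `1`.
  refine ⟨(1 + T) + u * (T * (T + 2)) * H, fun t => ?_⟩
  set φ := Polynomial.eval₂RingHom (algebraMap ℚ≥0 ℂ) (t : ℂ) with hφ
  have hφX : φ Polynomial.X = t := by simp [hφ]
  have hu' := congrArg (map φ) hu
  have hp' := congrArg (map φ) hp
  have hT' := congrArg (map φ) hT
  have hH' := congrArg (map φ) hH
  have hT0' : constantCoeff (map φ T) = 0 := by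
    rw [← coeff_zero_eq_constantCoeff_apply, coeff_map, coeff_zero_eq_constantCoeff_apply, hT0,
      map_zero]
  rw [← derivative_map] at hT'
  simp only [map_add, map_mul, map_pow, map_one, map_X, map_ofNat, map_C, hφX] at hu' hp' hT' hH' ⊢
  generalize map φ u = u' at *
  generalize map φ p = p' at *
  generalize map φ T = T' at *
  generalize map φ H = H' at *
  have key := pathSeries_closed_form (t := t) (u := u') (p := p') (T := 1 + T') hu'
    (by linear_combination hp') (by simp [hT0']) (by
      rw [map_add, derivative_one, zero_add, hT', map_natCast])
  linear_combination -H' * key + (-T' - 1 + pathSeries t t) * hH'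

end PowerSeries

/-! ### The corollary -/

theorem corollary5p2 (n : ℕ) (hn : 2 ≤ n) :
    ∃ Ω : ℚ[X],
      IsOrderPolynomial (ZigZag n) Ω ∧
      (∀ i : ℕ, 0 ≤ Ω.coeff i) ∧
      IsEhrhartPolynomial (orderPolytope (ZigZag n)) (Ω.comp (X + 1)) ∧
      EhrhartPositive (orderPolytope (ZigZag n)) := by
  obtain ⟨G, hG⟩ := PowerSeries.exists_series_map_eq_pathSeries
  have hΩ : IsOrderPolynomial (ZigZag n)
      ((PowerSeries.coeff n G).map (algebraMap ℚ≥0 ℚ)) := by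
    intro t _
    have h := congrArg (PowerSeries.coeff n) (hG t)
    rw [PowerSeries.coeff_map, pathSeries, PowerSeries.coeff_mk, coe_eval₂RingHom,
      ← card_zigZag_orderHom] at h
    rw [← Rat.cast_inj (α := ℂ)]
    push_cast
    rw [← h, eval_map, ← eq_ratCast (algebraMap ℚ ℂ), hom_eval₂, map_natCast]
    congr 1
  -- The shift by `1` can be made over `ℚ≥0`, hence keeps the coefficients nonnegative.
  have hcomp : (((PowerSeries.coeff n G).map (algebraMap ℚ≥0 ℚ)).comp (X + 1) : ℚ[X]) =
      ((PowerSeries.coeff n G).comp (X + 1)).map (algebraMap ℚ≥0 ℚ) := by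
    simp [Polynomial.map_comp]
  refine ⟨_, hΩ, fun i => ?_, hΩ.isEhrhartPolynomial, _, hΩ.isEhrhartPolynomial, fun i => ?_⟩
  · rw [coeff_map]
    exact NNRat.cast_nonneg _
  · rw [hcomp, coeff_map]
    exact NNRat.cast_nonneg _
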